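/- **Conventions.** Fix an alphabet: a signature $\Sigma$ of function symbols with arities, predicate symbols with arities, and a countably infinite set of variables. For $n\in\mathbb N$, $At(n)$ is the set of atoms whose variables are among $x_1,\dots,x_n$; occurrences of one atom in $At(n)$ and in $At(n')$, $n\ne n'$, are distinguished. A substitution $\theta\colon n\to m$ is an $n$-tuple of $\Sigma$-terms with variables among $x_1,\dots,x_m$; $A\theta\in At(m)$ is the corresponding instance of $A\in At(n)$, and $\sigma\circ\theta$ means first $\theta$, then $\sigma$. A logic program $\mathbb P$ is a finite set of clauses $H\leftarrow B_1,\dots,B_k$ ($k\ge 0$). A unifier of $A\in At(n)$ and the head $H$ of a clause $C$ is a pair $\langle\sigma,\tau\rangle$, with $\sigma\colon n\to m$ and $\tau$ assigning to each variable occurring in $C$ a term with variables among $x_1,\dots,x_m$, such that $A\sigma=H\tau$; it is most general if every unifier $\langle\sigma',\tau'\rangle$ factors uniquely as $\sigma'=\rho\circ\sigma$, $\tau'=\rho\circ\tau$. A term-matcher is a unifier with $\sigma=\mathrm{id}_n$. **Trees.** An and-or tree has $\wedge$-nodes, labelled with atoms and having $\vee$-nodes as children, and $\vee$-nodes, having $\wedge$-nodes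 as children; its root, at depth $0$, is an $\wedge$-node. In the *saturated $\wedge\vee$-tree* for $A\in At(n)$ the root is labelled $A$; an $\wedge$-node labelled $A'\in At(n')$ has exactly one child for each clause $H\leftarrow B_1,\dots,B_k$ of $\mathbb P$ and each unifier $\langle\sigma,\tau\rangle$ of $A'$ and $H$ as above, this child is labelled $\sigma$, and it has exactly one child labelled $B$ for each $B\in\{B_1,\dots,B_k\}\tau$ (an atom of $At(m')$ if $\sigma\colon n'\to m'$). The *$m$-coinductive tree* for an atom of $At(m)$ is defined in the same way, but only with term-matchers $\langle\mathrm{id}_m,\tau\rangle$ (so all labels of $\wedge$-nodes are in $At(m)$), and with all $\vee$-nodes labelled $\bullet$. A *derivation subtree* is a subtree containing the root, exactly one child of each of its $\wedge$-nodes and all children of each of its $\vee$-nodes. A *refutation subtree* is a finite derivation subtree with only $\vee$-nodes as leaves. In a saturated tree such a subtree is *synched* if all its $\vee$-nodes at the same depth carry the same substitution; the *answer* of a synched refutation subtree is then $\theta_{2k+1}\circ\cdots\circ\theta_3\circ\theta_1$, where $\theta_i$ labels its $\vee$-nodes at depth $i$ and $2k+1$ is its maximal depth. **SLD-resolution.**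 A step from a finite goal $G\subseteq At(n)$ selects $A'\in G$, a clause $H\leftarrow B_1,\dots,B_k$ of $\mathbb P$ and a most general unifier $\langle\sigma,\tau\rangle$ of $A'$ and $H$, and leads to the goal $\{B_1,\dots,B_k\}\tau\cup(G\setminus\{A'\})\sigma$. An SLD-refutation is a finite sequence of steps that ends in $\emptyset$; its computed answer is the composite of the substitutions $\sigma$ of its steps, and a correct answer is any $\sigma'\circ\tau'$ with $\tau'$ its computed answer. **Theorem (Soundness and Completeness).** Let $\mathbb P$ be a logic program, $A\in At(n)$ an atom and $\theta\colon n\to m$ a substitution. The following are equivalent. 1. The saturated $\wedge\vee$-tree for $A$ in $\mathbb P$ has a synched refutation subtree with answer $\theta$. 2. The $m$-coinductive tree for $A\theta$ in $\mathbb P$ has a refutation subtree. 3. There is an SLD-refutation of $\{A\}$ in $\mathbb P$ with correct answer $\theta$. -/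

import Mathlib

universe u v w

namespace LogicProg

/-! ### Terms, substitutions, atoms

An alphabet is a first-order language `L`: its function symbols form the signature, its relation
symbols are the predicate symbols. Terms over `L` with variables in `X` are Mathlib's `L.Term X`.
The `n` variables of the context `n` are the elements of `Fin n`; the countably infinite set of
variables from which clauses are written is `ℕ`. -/

/-- An arrow `n ⟶ m` of the opposite Lawvere theory of the signature: an `n`-tuple of terms in which
only the first `m` variables occur. -/
abbrev Subst (L : FirstOrder.Language.{u, v}) (n m : ℕ) : Type u := Fin n → L.Term (Fin m)

/-- The identity substitution. -/
def Subst.id (L : FirstOrder.Language.{u, v}) (n : ℕ) : Subst L n n := fun i => FirstOrder.Language.Term.var i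

/-- The composite `θ ∘ σ` (first `σ`, then `θ`): each variable `j` of the terms of `σ` is replaced
by `θ j`. -/
def Subst.andThen {L : FirstOrder.Language.{u, v}} {n m k : ℕ} (σ : Subst L n m) (θ : Subst L m k) :
    Subst L n k := fun i => (σ i).subst θ

/-- An atom `R(t₁, …, tₖ)` with variables in `X`. The set `At(n)` is `Atom L (Fin n)`. -/
structure Atom (L : FirstOrder.Language.{u, v}) (X : Type) : Type (max u v) where
  arity : ℕ
  pred : L.Relations arity
  args : Fin arity → L.Term X

/-- The substitution instance `A τ` of an atom. -/
def Atom.subst {L : FirstOrder.Language.{u, v}} {X Y : Type} (A : Atom L X) (τ : X → L.Term Y) : Atom L Y :=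
  ⟨A.arity, A.pred, fun i => (A.args i).subst τ⟩

/-- The set of variables that occur in an atom. -/
def Atom.vars {L : FirstOrder.Language.{u, v}} (A : Atom L ℕ) : Set ℕ :=
  {x | ∃ i, x ∈ (A.args i).varFinset}

/-- The same atom, seen as an atom over a set `S` of variables that contains all its variables. -/
def Atom.restrict {L : FirstOrder.Language.{u, v}} (A : Atom L ℕ) (S : Set ℕ) (h : A.vars ⊆ S) : Atom L S :=
  ⟨A.arity, A.pred, fun i => (A.args i).restrictVar fun x => ⟨x.1, h ⟨i, x.2⟩⟩⟩

/-! ### Logic programs -/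

/-- A clause `H ← B₁, …, Bₖ`. -/
structure Clause (L : FirstOrder.Language.{u, v}) : Type (max u v) where
  head : Atom L ℕ
  body : List (Atom L ℕ)

/-- A logic program is a finite set of clauses. -/
abbrev Program (L : FirstOrder.Language.{u, v}) : Type (max u v) := Finset (Clause L)

namespace Clause

variable {L : FirstOrder.Language.{u, v}}

/-- The variables that occur in a clause. -/
def vars (C : Clause L) : Set ℕ := {x | x ∈ C.head.vars ∨ ∃ B ∈ C.body, x ∈ B.vars}

/-- The instance `H τ` of the head, for a substitution `τ` of the variables of the clause by terms
in the context `m`. -/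
def headInst (C : Clause L) {m : ℕ} (τ : C.vars → L.Term (Fin m)) : Atom L (Fin m) :=
  (C.head.restrict C.vars fun _ hx => Or.inl hx).subst τ

/-- The set `{B₁, …, Bₖ} τ` of instances of the atoms of the body. -/
def bodyInst (C : Clause L) {m : ℕ} (τ : C.vars → L.Term (Fin m)) : Set (Atom L (Fin m)) :=
  {B' | ∃ (B : Atom L ℕ) (hB : B ∈ C.body),
    B' = (B.restrict C.vars fun _ hx => Or.inr ⟨B, hB, hx⟩).subst τ}

end Clause

/-! ### SLD-resolution -/

section SLD

variable {L : FirstOrder.Language.{u, v}}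

/-- `⟨σ, τ⟩` is a most general unifier of the atom `A` (in context `n`) and the head of `C`: it is a
unifier through which every unifier factors uniquely, that is, a pushout. The variables of `A` and
those of `C` are kept apart because `σ` and `τ` have different sources. -/
def IsMGU {n m : ℕ} (A : Atom L (Fin n)) (C : Clause L)
    (σ : Subst L n m) (τ : C.vars → L.Term (Fin m)) : Prop :=
  A.subst σ = C.headInst τ ∧
    ∀ (k : ℕ) (σ' : Subst L n k) (τ' : C.vars → L.Term (Fin k)),
      A.subst σ' = C.headInst τ' →
        ∃! ρ : Subst L m k, (∀ i, (σ i).subst ρ = σ' i) ∧ ∀ x, (τ x).subst ρ = τ' x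

/-- `ComputedAnswer P G θ`: some SLD-refutation of the goal `G` in `P` has computed answer `θ`.
A refutation stops at the empty goal; a step selects an atom `A` of the goal `G` and a clause `C`
of the program with a most general unifier `⟨σ, τ⟩` of `A` and the head of `C`, and passes to
the goal `{B₁, …, Bₖ} τ ∪ (G \ {A}) σ`. -/
inductive ComputedAnswer (P : Program L) :
    {n m : ℕ} → Set (Atom L (Fin n)) → Subst L n m → Prop
  | done (n : ℕ) : ComputedAnswer P (∅ : Set (Atom L (Fin n))) (Subst.id L n)
  | step {n k m : ℕ} (G : Set (Atom L (Fin n))) (A : Atom L (Fin n)) (hA : A ∈ G)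
      (C : Clause L) (hC : C ∈ P) (σ : Subst L n k) (τ : C.vars → L.Term (Fin k))
      (hmgu : IsMGU A C σ τ) (ρ : Subst L k m)
      (hrest : ComputedAnswer P (C.bodyInst τ ∪ (fun B => B.subst σ) '' (G \ {A})) ρ) :
      ComputedAnswer P G (σ.andThen ρ)

/-- `θ` is a correct answer of an SLD-refutation of `G` in `P`: it factors through a computed
answer. -/
def CorrectAnswer (P : Program L) {n m : ℕ} (G : Set (Atom L (Fin n))) (θ : Subst L n m) : Prop :=
  ∃ (k : ℕ) (τ : Subst L n k) (σ : Subst L k m), ComputedAnswer P G τ ∧ τ.andThen σ = θ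

end SLD

/-! ### And-or trees -/

/-- A recipe for and-or trees: the possible labels of `∧`-nodes, the `∨`-nodes below an `∧`-node
with a given label, and the set of labels of the `∧`-nodes below such an `∨`-node. -/
structure AndOrRules : Type (w + 1) where
  Label : Type w
  Alt : Label → Type w
  goals : {s : Label} → Alt s → Set Label

namespace AndOrRules

variable (R : AndOrRules.{w})

/-- The `∧`-nodes labelled `s` of the and-or tree whose root is an `∧`-node labelled `r`. A node is
given by the path that leads to it: below each `∧`-node labelled `s` there is exactly one `∨`-node
for each `a : R.Alt s`, and below that exactly one `∧`-node for each label in `R.goals a`. -/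
inductive AndPath (r : R.Label) : R.Label → Type w
  | root : AndPath r r
  | child {s : R.Label} (p : AndPath r s) (a : R.Alt s) (s' : R.Label) (h : s' ∈ R.goals a) :
      AndPath r s'

/-- The depth of an `∧`-node: the root has depth `0`, and a grandchild is two levels deeper. -/
def AndPath.depth {R : AndOrRules.{w}} {r : R.Label} : {s : R.Label} → R.AndPath r s → ℕ
  | _, .root => 0
  | _, .child p _ _ _ => p.depth + 2

/-- The `∧`-nodes of the tree with root labelled `r`. -/
structure AndNode (r : R.Label) where
  label : R.Label
  path : R.AndPath r label

/-- The `∨`-nodes of the tree with root labelled `r`, each given by its parent and by the choice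
made there. -/
structure OrNode (r : R.Label) where
  parent : R.AndNode r
  alt : R.Alt parent.label

/-- The depth of an `∨`-node is one more than that of its parent. -/
def OrNode.depth {R : AndOrRules.{w}} {r : R.Label} (o : R.OrNode r) : ℕ :=
  o.parent.path.depth + 1

/-- The child labelled `s` of an `∨`-node. -/
def OrNode.child {R : AndOrRules.{w}} {r : R.Label} (o : R.OrNode r) (s : R.Label)
    (h : s ∈ R.goals o.alt) : R.AndNode r :=
  ⟨s, .child o.parent.path o.alt s h⟩

/-- A derivation subtree of the tree with root labelled `r`: a set of nodes that contains the root
and the parent of each of its members (so it forms a subtree with the same root), exactly one child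
of each of its `∧`-nodes, and all children of each of its `∨`-nodes. -/
structure DerivationSubtree (r : R.Label) where
  ands : Set (R.AndNode r)
  ors : Set (R.OrNode r)
  parent_mem_ands : ∀ o ∈ ors, o.parent ∈ ands
  parent_mem_ors : ∀ (o : R.OrNode r) (s : R.Label) (h : s ∈ R.goals o.alt),
    o.child s h ∈ ands → o ∈ ors
  root_mem : ⟨r, .root⟩ ∈ ands
  one_child : ∀ p ∈ ands, ∃! o : R.OrNode r, o ∈ ors ∧ o.parent = p
  all_children : ∀ o ∈ ors, ∀ (s : R.Label) (h : s ∈ R.goals o.alt), o.child s h ∈ ands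

/-- A refutation subtree is a finite derivation subtree in which no `∧`-node is a leaf. -/
def DerivationSubtree.IsRefutation {R : AndOrRules.{w}} {r : R.Label}
    (T : R.DerivationSubtree r) : Prop :=
  T.ands.Finite ∧ T.ors.Finite ∧ ∀ p ∈ T.ands, ∃ o ∈ T.ors, o.parent = p

end AndOrRules

/-! ### Coinductive trees -/

section Coinductive

variable {L : FirstOrder.Language.{u, v}}

/-- A clause of `P` together with a term-matcher of `A` and the head of that clause. -/
structure Matcher (P : Program L) {n : ℕ} (A : Atom L (Fin n)) where
  clause : Clause L
  mem : clause ∈ P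
  τ : clause.vars → L.Term (Fin n)
  eq : A = clause.headInst τ

/-- The `n`-coinductive tree for `A ∈ At(n)` in `P` is the tree with root labelled `A` that these
rules generate (the label `•` of all `∨`-nodes carries no information). -/
def coinductiveRules (P : Program L) (n : ℕ) : AndOrRules.{max u v} where
  Label := Atom L (Fin n)
  Alt A := Matcher P A
  goals a := a.clause.bodyInst a.τ

end Coinductive

/-! ### Saturated trees -/

section Saturated

variable {L : FirstOrder.Language.{u, v}}

/-- A clause of `P` together with a unifier `⟨σ, τ⟩` of `A` and the head of that clause. -/
structure Unifier (P : Program L) {n : ℕ} (A : Atom L (Fin n)) where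
  clause : Clause L
  mem : clause ∈ P
  target : ℕ
  σ : Subst L n target
  τ : clause.vars → L.Term (Fin target)
  eq : A.subst σ = clause.headInst τ

/-- The saturated and-or tree for `A ∈ At(n)` in `P` is the tree with root labelled `⟨n, A⟩` that
these rules generate. -/
def saturatedRules (P : Program L) : AndOrRules.{max u v} where
  Label := Σ n : ℕ, Atom L (Fin n)
  Alt s := Unifier P s.2
  goals a := {s | ∃ B ∈ a.clause.bodyInst a.τ, s = ⟨a.target, B⟩}

/-- Substitutions with arbitrary source and target. -/
abbrev Arrow (L : FirstOrder.Language.{u, v}) : Type u := Σ n m : ℕ, Subst L n m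

/-- The substitution `σ` that labels an `∨`-node of a saturated tree. -/
def orLabel {P : Program L} {r : (saturatedRules P).Label} (o : (saturatedRules P).OrNode r) :
    Arrow L :=
  ⟨o.parent.label.1, Unifier.target o.alt, Unifier.σ o.alt⟩

/-- All `∨`-nodes of the subtree at the same depth are labelled with the same substitution. -/
def IsSynched {P : Program L} {r : (saturatedRules P).Label}
    (T : (saturatedRules P).DerivationSubtree r) : Prop :=
  ∀ o ∈ T.ors, ∀ o' ∈ T.ors, o.depth = o'.depth → orLabel o = orLabel o'

/-- `IsComposite [σ₁, …, σₖ] θ`: the substitutions are composable and `θ = σₖ ∘ ⋯ ∘ σ₁`. -/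
inductive IsComposite : List (Arrow L) → {n m : ℕ} → Subst L n m → Prop
  | nil (n : ℕ) : IsComposite [] (Subst.id L n)
  | cons {n m k : ℕ} (σ : Subst L n m) (l : List (Arrow L)) (θ : Subst L m k)
      (h : IsComposite l θ) : IsComposite (⟨n, m, σ⟩ :: l) (σ.andThen θ)

/-- `θ` is the answer of the (synched refutation) subtree `T`: the composite, in order of depth, of
the labels of its `∨`-nodes at depths `1, 3, …, 2k + 1`, the last of which is the maximal depth. -/
def HasAnswer {P : Program L} {r : (saturatedRules P).Label}
    (T : (saturatedRules P).DerivationSubtree r) {n m : ℕ} (θ : Subst L n m) : Prop :=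
  ∃ l : List (Arrow L),
    (∀ i < l.length, ∃ o ∈ T.ors, o.depth = 2 * i + 1) ∧
    (∀ o ∈ T.ors, ∃ i, o.depth = 2 * i + 1 ∧ l[i]? = some (orLabel o)) ∧
    IsComposite l θ

end Saturated

end LogicProg

/-!
All three conditions are compared with a fourth one: the instance `Aθ` is solvable by term matching
within some height (`MatchSolvable`), where `AndOrRules.Solvable` says, for arbitrary and-or trees,
that below an `∧`-node one can choose an `∨`-node all of whose children are solvable within a smaller
height. A refutation subtree is the same thing as a winning strategy of finite height, since every
`∨`-node has finitely many children (`DerivationSubtree.IsRefutation.exists_solvable`,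
`AndOrRules.exists_isRefutation`). This settles the coinductive tree.

*Saturated trees.* In a refutation subtree with an answer, instantiating an `∧`-node at depth `2 * i`
by the composite of the labels at depths `2 * i + 1, 2 * i + 3, …` turns the chosen unifiers into
term-matchers, so that the instance is solvable (`HasAnswer.exists_matchSolvable`). Conversely, if
`⟨id, τ⟩` matches `Aθ` with the head of a clause, then `⟨θ, τ⟩` unifies `A` with it. A strategy for
`Aθ` therefore becomes a synched refutation subtree for `A` that carries `θ` at depth `1` and
identities below (`exists_isSynched_of_matchSolvable`).

*SLD-resolution.* Soundness is an induction on the refutation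
(`ComputedAnswer.exists_matchSolvable`). For completeness, a matching step on an instance of a goal
is a unifier for the goal itself. It factors through a most general one, which yields an SLD-step
(`Liftable.cons_of_matcher`). The induction is on the strategy for the first atom of the list of
instances, with the rest of the list as a continuation, so that the atoms of a goal that become equal
after instantiation cause no trouble.

*Most general unifiers.* Their existence in the strong sense of unique factorization is the
unification algorithm (`hasMGU_of_solves`). As a solution `σ` is given, its termination is an
induction on the terms `sσ` for the left-hand sides `s` of the equations: eliminating a variable does
not change these terms, and decomposing an equation replaces one of them by its immediate subterms.
-/

namespace LogicProg

open FirstOrder.Language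

/-! ### Substitution in terms -/

section Terms

variable {L : FirstOrder.Language.{u, v}} {X Y Z : Type}

theorem term_subst_var (t : L.Term X) : t.subst Term.var = t := by
  induction t with
  | var => rfl
  | func f ts ih => simp [Term.subst, ih]

theorem term_subst_subst (t : L.Term X) (σ : X → L.Term Y) (τ : Y → L.Term Z) :
    (t.subst σ).subst τ = t.subst fun x => (σ x).subst τ := by
  induction t with
  | var => rfl
  | func f ts ih => simp [Term.subst, ih]

theorem term_restrictVar_subst [DecidableEq X] (t : L.Term X) (f : t.varFinset → Y)
    (σ : X → L.Term Z) (τ : Y → L.Term Z) (h : ∀ x, τ (f x) = σ x) :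
    (t.restrictVar f).subst τ = t.subst σ := by
  induction t with
  | var => exact h _
  | func g ts ih =>
    simp only [Term.restrictVar, Term.subst]
    congr 1
    funext i
    exact ih i _ fun x => h _

/-- The number of nodes of a term. -/
noncomputable def termSize : L.Term X → ℕ
  | .var _ => 1
  | .func _ ts => 1 + ∑ i, termSize (ts i)

theorem termSize_le_of_mem_varFinset [DecidableEq X] {t : L.Term X} {x : X}
    (hx : x ∈ t.varFinset) (σ : X → L.Term Y) : termSize (σ x) ≤ termSize (t.subst σ) := by
  induction t with
  | var y =>
    obtain rfl : x = y := by simpa [Term.varFinset] using hx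
    exact le_rfl
  | func f ts ih =>
    obtain ⟨i, hi⟩ : ∃ i, x ∈ (ts i).varFinset := by simpa [Term.varFinset] using hx
    have h := Finset.single_le_sum (f := fun i => termSize ((ts i).subst σ))
      (fun _ _ => Nat.zero_le _) (Finset.mem_univ i)
    simp only [Term.subst, termSize]
    exact (ih i hi).trans (h.trans (Nat.le_add_left _ _))

/-- The occurs check: an equation between a variable and a compound term in which it occurs has no
solution. -/
theorem not_mem_varFinset_of_subst_eq [DecidableEq X] {l : ℕ} {f : L.Functions l}
    {ts : Fin l → L.Term X} {x : X} {σ : X → L.Term Y}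
    (h : σ x = (Term.func f ts).subst σ) : x ∉ (Term.func f ts).varFinset := by
  intro hx
  obtain ⟨i, hi⟩ : ∃ i, x ∈ (ts i).varFinset := by simpa [Term.varFinset] using hx
  have h₁ := termSize_le_of_mem_varFinset hi σ
  have h₂ := Finset.single_le_sum (f := fun i => termSize ((ts i).subst σ))
    (fun _ _ => Nat.zero_le _) (Finset.mem_univ i)
  have h₃ := congrArg termSize h
  simp only [Term.subst, termSize] at h₂ h₃
  omega

end Terms

/-! ### Unification -/

section Unification

variable {L : FirstOrder.Language.{u, v}} {X Y Z : Type}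

/-- `σ` solves every equation `s = t` of the list `E`. -/
def Solves (σ : X → L.Term Y) (E : List (L.Term X × L.Term X)) : Prop :=
  ∀ e ∈ E, e.1.subst σ = e.2.subst σ

/-- The system `E` has a most general solution, with values in a context `Fin m`. -/
def HasMGU (E : List (L.Term X × L.Term X)) : Prop :=
  ∃ (m : ℕ) (σ : X → L.Term (Fin m)), Solves σ E ∧
    ∀ (k : ℕ) (σ' : X → L.Term (Fin k)), Solves σ' E →
      ∃! ρ : Fin m → L.Term (Fin k), ∀ x, (σ x).subst ρ = σ' x

theorem HasMGU.congr {E E' : List (L.Term X × L.Term X)} (h : HasMGU E)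
    (hE : ∀ (k : ℕ) (σ : X → L.Term (Fin k)), Solves σ E ↔ Solves σ E') : HasMGU E' := by
  obtain ⟨m, σ, hσ, hu⟩ := h
  exact ⟨m, σ, (hE _ _).1 hσ, fun k σ' h' => hu k σ' ((hE _ _).2 h')⟩

theorem hasMGU_nil [Finite X] : HasMGU ([] : List (L.Term X × L.Term X)) := by
  obtain ⟨m, ⟨e⟩⟩ := Finite.exists_equiv_fin X
  refine ⟨m, fun x => .var (e x), by simp [Solves], fun k σ' _ =>
    ⟨fun i => σ' (e.symm i), fun x => by simp [Term.subst], fun ρ hρ => ?_⟩⟩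
  funext i
  simpa [Term.subst] using hρ (e.symm i)

/-- The substitution that eliminates the variable `x` in favour of a term `t` in which it does not
occur. -/
noncomputable def elimVar [DecidableEq X] (x : X) (t : L.Term X) (hx : x ∉ t.varFinset) :
    X → L.Term {y : X // y ≠ x} := fun y =>
  if h : y = x then t.restrictVar fun z => ⟨z.1, fun hz => hx (hz ▸ z.2)⟩ else .var ⟨y, h⟩

theorem elimVar_subst [DecidableEq X] {x : X} {t : L.Term X} (hx : x ∉ t.varFinset)
    {σ : X → L.Term Y} (h : σ x = t.subst σ) (y : X) :
    (elimVar x t hx y).subst (fun z => σ z.1) = σ y := by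
  unfold elimVar
  split_ifs with hy
  · rw [hy, h]
    exact term_restrictVar_subst t _ σ _ fun _ => rfl
  · rfl

theorem subst_elimVar_eq [DecidableEq X] {x : X} {t : L.Term X} (hx : x ∉ t.varFinset) :
    t.subst (elimVar x t hx) = elimVar x t hx x := by
  have h : elimVar x t hx x = t.restrictVar fun z => ⟨z.1, fun hz => hx (hz ▸ z.2)⟩ := by
    simp [elimVar]
  rw [h, ← term_subst_var (t.restrictVar _)]
  refine (term_restrictVar_subst t _ _ _ fun z => ?_).symm
  have hz : z.1 ≠ x := fun hz => hx (hz ▸ z.2)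
  simp [elimVar, hz]

theorem hasMGU_cons_of_elimVar [DecidableEq X] {x : X} {t : L.Term X} (hx : x ∉ t.varFinset)
    {E : List (L.Term X × L.Term X)}
    (h : HasMGU (E.map fun e => (e.1.subst (elimVar x t hx), e.2.subst (elimVar x t hx)))) :
    HasMGU ((.var x, t) :: E) := by
  obtain ⟨m, σ, hσ, hu⟩ := h
  have key : ∀ (k : ℕ) (τ : {y : X // y ≠ x} → L.Term (Fin k)),
      Solves (fun y => (elimVar x t hx y).subst τ) E ↔
      Solves τ (E.map fun e => (e.1.subst (elimVar x t hx), e.2.subst (elimVar x t hx))) := by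
    intro k τ
    simp only [Solves, List.forall_mem_map, term_subst_subst]
  refine ⟨m, fun y => (elimVar x t hx y).subst σ, ?_, fun k σ' hσ' => ?_⟩
  · intro e he
    rcases List.mem_cons.1 he with rfl | he
    · simp only [← term_subst_subst, subst_elimVar_eq]
      rfl
    · exact (key m σ).2 hσ e he
  · have hx' : σ' x = t.subst σ' := hσ' _ List.mem_cons_self
    have hel := elimVar_subst hx hx'
    obtain ⟨ρ, hρ, huniq⟩ := hu k (fun z => σ' z.1) <| (key k _).1 <| by
      simp only [hel]
      exact fun e he => hσ' e (List.mem_cons_of_mem _ he)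
    refine ⟨ρ, fun y => ?_, fun ρ' hρ' => huniq ρ' fun z => ?_⟩
    · simp only [term_subst_subst, hρ, hel]
    · have := hρ' z.1
      simpa [elimVar, z.2, Term.subst] using this

/-- `SolvableImpliesMGU l`: a system of equations has a most general solution as soon as it has
a solution `σ` under which its left-hand sides become the terms of `l`. -/
def SolvableImpliesMGU {k : ℕ} (l : List (L.Term (Fin k))) : Prop :=
  ∀ (X : Type) [Finite X] (E : List (L.Term X × L.Term X)) (σ : X → L.Term (Fin k)),
    Solves σ E → (E.map fun e => e.1.subst σ) = l → HasMGU E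

/-- An equation with a variable on its left-hand side is used to eliminate that variable, which
does not affect the solved form of the remaining equations. -/
theorem hasMGU_var_cons {k : ℕ} {l : List (L.Term (Fin k))} (hl : SolvableImpliesMGU l)
    (X : Type) [Finite X] (x : X) (t : L.Term X) (E : List (L.Term X × L.Term X))
    (σ : X → L.Term (Fin k)) (hσ : Solves σ ((.var x, t) :: E))
    (hE : (E.map fun e => e.1.subst σ) = l) : HasMGU ((.var x, t) :: E) := by
  classical
  have hxt : σ x = t.subst σ := hσ _ List.mem_cons_self
  have hE' : Solves σ E := fun e he => hσ e (List.mem_cons_of_mem _ he)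
  by_cases htx : t = .var x
  · subst htx
    refine (hl X E σ hE' hE).congr fun k σ => ?_
    simp [Solves]
  have hx : x ∉ t.varFinset := by
    cases t with
    | var y =>
      rintro h
      obtain rfl : x = y := by simpa [Term.varFinset] using h
      exact htx rfl
    | func f ts => exact not_mem_varFinset_of_subst_eq hxt
  refine hasMGU_cons_of_elimVar hx (hl _ _ (fun z => σ z.1) ?_ ?_)
  · simpa only [Solves, List.forall_mem_map, term_subst_subst, elimVar_subst hx hxt] using hE'
  · simpa [term_subst_subst, elimVar_subst hx hxt, Function.comp_def] using hE

theorem SolvableImpliesMGU.append {k : ℕ} {us l : List (L.Term (Fin k))}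
    (hus : ∀ u ∈ us, ∀ l : List (L.Term (Fin k)), SolvableImpliesMGU l →
      SolvableImpliesMGU (u :: l)) (hl : SolvableImpliesMGU l) :
    SolvableImpliesMGU (us ++ l) := by
  induction us with
  | nil => exact hl
  | cons u us ih =>
    exact hus u List.mem_cons_self _ (ih fun u' hu' => hus u' (List.mem_cons_of_mem _ hu'))

/-- Decomposing an equation between compound terms replaces the solved left-hand side `u` by its
immediate subterms; so the unification algorithm terminates by induction on `u`. -/
theorem SolvableImpliesMGU.cons {k : ℕ} (u : L.Term (Fin k)) :
    ∀ l : List (L.Term (Fin k)), SolvableImpliesMGU l → SolvableImpliesMGU (u :: l) := by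
  induction u with
  | var i =>
    intro l hl X _ E σ hσ hE
    match E, hσ, hE with
    | (.var x, t) :: E, hσ, hE => exact hasMGU_var_cons hl X x t E σ hσ (List.cons.inj hE).2
    | (.func f ts, t) :: E, hσ, hE => exact absurd (List.cons.inj hE).1 (by simp [Term.subst])
  | func g us ih =>
    intro l hl X _ E σ hσ hE
    match E, hσ, hE with
    | (.var x, t) :: E, hσ, hE => exact hasMGU_var_cons hl X x t E σ hσ (List.cons.inj hE).2
    | (.func f ts, .var x) :: E, hσ, hE =>
      have hswap : ∀ (k : ℕ) (σ : X → L.Term (Fin k)),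
          Solves σ ((.var x, .func f ts) :: E) ↔ Solves σ ((.func f ts, .var x) :: E) := by
        simp [Solves, eq_comm]
      exact (hasMGU_var_cons hl X x (.func f ts) E σ ((hswap _ _).2 hσ)
        (List.cons.inj hE).2).congr hswap
    | (.func (l := a) f ts, .func (l := b) f' ts') :: E, hσ, hE =>
      have h := hσ _ List.mem_cons_self
      simp only [Term.subst, Term.func.injEq] at h
      obtain ⟨rfl, h, -⟩ := h
      obtain rfl := eq_of_heq h
      have h := (List.cons.inj hE).1
      simp only [Term.subst, Term.func.injEq] at h
      obtain ⟨rfl, h, hts⟩ := h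
      obtain rfl := eq_of_heq h
      have hdec : ∀ (k : ℕ) (σ : X → L.Term (Fin k)),
          Solves σ ((List.ofFn fun i => (ts i, ts' i)) ++ E) ↔
            Solves σ ((.func f ts, .func f ts') :: E) := by
        intro k σ
        simp [Solves, or_imp, forall_and, Term.subst, List.mem_ofFn, funext_iff]
      refine HasMGU.congr (SolvableImpliesMGU.append (us := List.ofFn us) ?_ hl X _ σ
        ((hdec _ _).2 hσ) ?_) hdec
      · intro u hu
        obtain ⟨i, rfl⟩ := (List.mem_ofFn' _ _).1 hu
        exact ih i
      · rw [List.map_append, (List.cons.inj hE).2, List.map_ofFn, ← eq_of_heq hts]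
        rfl

theorem hasMGU_of_solves [Finite X] {E : List (L.Term X × L.Term X)} {k : ℕ}
    {σ : X → L.Term (Fin k)} (h : Solves σ E) : HasMGU E := by
  have hnil : SolvableImpliesMGU ([] : List (L.Term (Fin k))) := by
    intro X _ E σ _ hE
    obtain rfl := List.map_eq_nil_iff.1 hE
    exact hasMGU_nil
  have := SolvableImpliesMGU.append (us := E.map fun e => e.1.subst σ)
    (fun u _ => SolvableImpliesMGU.cons u) hnil
  exact this X E σ h (by simp)

/-- A pair of atoms without common variables that has a unifier has a most general one. -/
theorem exists_atom_mgu [Finite X] [Finite Y] (A : Atom L X) (B : Atom L Y) {k : ℕ}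
    (θ : X → L.Term (Fin k)) (τ : Y → L.Term (Fin k)) (h : A.subst θ = B.subst τ) :
    ∃ (m : ℕ) (σ : X → L.Term (Fin m)) (τ : Y → L.Term (Fin m)), A.subst σ = B.subst τ ∧
      ∀ (k : ℕ) (σ' : X → L.Term (Fin k)) (τ' : Y → L.Term (Fin k)),
        A.subst σ' = B.subst τ' →
          ∃! ρ : Fin m → L.Term (Fin k),
            (∀ x, (σ x).subst ρ = σ' x) ∧ ∀ y, (τ y).subst ρ = τ' y := by
  obtain ⟨a, p, s⟩ := A
  obtain ⟨b, q, t⟩ := B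
  obtain ⟨rfl, hpq, -⟩ := Atom.mk.inj h
  obtain rfl := eq_of_heq hpq
  let E : List (L.Term (X ⊕ Y) × L.Term (X ⊕ Y)) := List.ofFn fun i =>
    ((s i).subst fun x => .var (.inl x), (t i).subst fun y => .var (.inr y))
  have key : ∀ (k : ℕ) (σ : X ⊕ Y → L.Term (Fin k)), Solves σ E ↔
      Atom.subst ⟨a, p, s⟩ (fun x => σ (.inl x)) = Atom.subst ⟨a, p, t⟩ fun y => σ (.inr y) := by
    intro k σ
    simp [Solves, E, List.mem_ofFn, term_subst_subst, Term.subst, Atom.subst, funext_iff]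
  obtain ⟨m, σ, hσ, hu⟩ := hasMGU_of_solves ((key k (Sum.elim θ τ)).2 h)
  refine ⟨m, fun x => σ (.inl x), fun y => σ (.inr y), (key m σ).1 hσ, fun k σ' τ' h' => ?_⟩
  simpa only [Sum.forall, Sum.elim_inl, Sum.elim_inr] using hu k (Sum.elim σ' τ') ((key k _).2 h')

end Unification

/-! ### Refutation subtrees and solvable labels -/

namespace AndOrRules

variable {R : AndOrRules.{w}}

/-- `R.Solvable k s`: the tree with root labelled `s` has a strategy that ends after at most `k`
choices on every branch. That is, one can choose an `∨`-node below the root all of whose children are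
solvable within `k - 1` choices. No label is solvable within `0` choices. -/
inductive Solvable (R : AndOrRules.{w}) : ℕ → R.Label → Prop
  | intro {k : ℕ} {s : R.Label} (a : R.Alt s) (h : ∀ s' ∈ R.goals a, Solvable R k s') :
      Solvable R (k + 1) s

theorem Solvable.mono {k l : ℕ} {s : R.Label} (h : R.Solvable k s) (hkl : k ≤ l) :
    R.Solvable l s := by
  induction h generalizing l with
  | intro a _ ih =>
    obtain ⟨l, rfl⟩ := Nat.exists_eq_add_of_le' (Nat.le_of_add_left_le hkl)
    exact .intro a fun s' hs' => ih s' hs' (by omega)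

theorem exists_solvable {s : R.Label} (a : R.Alt s) (hfin : (R.goals a).Finite)
    (h : ∀ s' ∈ R.goals a, ∃ k, R.Solvable k s') : ∃ k, R.Solvable k s := by
  have key : ∀ᶠ k in Filter.atTop, ∀ s' ∈ R.goals a, R.Solvable k s' := by
    rw [Filter.eventually_all_finite hfin]
    intro s' hs'
    obtain ⟨k, hk⟩ := h s' hs'
    exact (Filter.eventually_ge_atTop k).mono fun l hl => hk.mono hl
  obtain ⟨k, hk⟩ := key.exists
  exact ⟨k + 1, .intro a hk⟩

theorem DerivationSubtree.IsRefutation.exists_solvable {r : R.Label} {T : R.DerivationSubtree r}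
    (hT : T.IsRefutation) : ∃ k, R.Solvable k r := by
  obtain ⟨hfin, -, hleaf⟩ := hT
  obtain ⟨D, hD⟩ := (hfin.image fun p => p.path.depth).bddAbove
  have key : ∀ k, ∀ p ∈ T.ands, D < p.path.depth + k → R.Solvable k p.label := by
    intro k
    induction k with
    | zero =>
      intro p hp hlt
      have : p.path.depth ≤ D := hD (Set.mem_image_of_mem _ hp)
      omega
    | succ k ih =>
      intro p hp hlt
      obtain ⟨o, ho, rfl⟩ := hleaf p hp
      refine .intro o.alt fun s hs => ih (o.child s hs) (T.all_children o ho s hs) ?_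
      simp only [OrNode.child, AndPath.depth]
      omega
  exact ⟨D + 1, key _ _ T.root_mem (by omega)⟩

/-- The paths to the `∧`-nodes of depth `2 * i` that are reached when below an `∧`-node of depth
`2 * j` labelled `s` only the `∨`-nodes in `S j s` are visited. -/
inductive Follows {r : R.Label} (S : ℕ → (s : R.Label) → R.Alt s → Prop) :
    ℕ → {s : R.Label} → R.AndPath r s → Prop
  | root : Follows S 0 .root
  | child {i : ℕ} {s : R.Label} {p : R.AndPath r s} {a : R.Alt s} (hp : Follows S i p)
      (ha : S i s a) (s' : R.Label) (h : s' ∈ R.goals a) : Follows S (i + 1) (.child p a s' h)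

theorem Follows.depth_eq {r : R.Label} {S : ℕ → (s : R.Label) → R.Alt s → Prop} {i : ℕ}
    {s : R.Label} {p : R.AndPath r s} (h : Follows S i p) : p.depth = 2 * i := by
  induction h with
  | root => rfl
  | child _ _ _ _ ih => simp only [AndPath.depth, ih]; ring

/-- A strategy that may depend on the depth, and that decreases a rank at every move, spans
a refutation subtree. Here `Good i k s` says that the label `s` is admissible at depth `2 * i` with
rank `k`, and `Q` records properties of the chosen `∨`-nodes. -/
theorem exists_isRefutation (hfin : ∀ (s : R.Label) (a : R.Alt s), (R.goals a).Finite)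
    {r : R.Label} (Good : ℕ → ℕ → R.Label → Prop) (Q : ℕ → (s : R.Label) → R.Alt s → Prop)
    (hstep : ∀ i k s, Good i k s →
      ∃ a : R.Alt s, Q i s a ∧ ∃ k' < k, ∀ s' ∈ R.goals a, Good (i + 1) k' s')
    {K : ℕ} (hr : Good 0 K r) :
    ∃ T : R.DerivationSubtree r, T.IsRefutation ∧
      ∀ o ∈ T.ors, ∃ i, o.depth = 2 * i + 1 ∧ Q i o.parent.label o.alt := by
  classical
  -- The move chosen at a label is one for its least rank, so that ranks decrease along all paths.
  have hmove : ∀ (i : ℕ) (s : R.Label) (h : ∃ k, Good i k s),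
      ∃ a : R.Alt s, Q i s a ∧ ∀ s' ∈ R.goals a, ∃ k' < Nat.find h, Good (i + 1) k' s' := by
    intro i s h
    obtain ⟨a, ha, k', hk', hs⟩ := hstep i _ s (Nat.find_spec h)
    exact ⟨a, ha, fun s' hs' => ⟨k', hk', hs s' hs'⟩⟩
  choose f hfQ hf using hmove
  let S : ℕ → (s : R.Label) → R.Alt s → Prop := fun i s a => ∃ h, a = f i s h
  have hgood : ∀ {i : ℕ} {s : R.Label} {p : R.AndPath r s}, Follows S i p →
      ∃ k, Good i k s ∧ k + i ≤ K := by
    intro i s p h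
    induction h with
    | root => exact ⟨K, hr, le_rfl⟩
    | child hp ha s' hs' ih =>
      obtain ⟨k, hk, hkK⟩ := ih
      obtain ⟨h, rfl⟩ := ha
      obtain ⟨k', hk', hG⟩ := hf _ _ h s' hs'
      have := Nat.find_min' h hk
      exact ⟨k', hG, by omega⟩
  let ands : ℕ → Set (R.AndNode r) := fun i => {p | Follows S i p.path}
  let ors : ℕ → Set (R.OrNode r) := fun i => {o | Follows S i o.parent.path ∧ S i _ o.alt}
  have hinj : ∀ i, ∀ o ∈ ors i, ∀ o' ∈ ors i, o.parent = o'.parent → o = o' := by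
    rintro i ⟨p, a⟩ ⟨-, h, ha⟩ ⟨p', a'⟩ ⟨-, h', ha'⟩ heq
    cases heq
    simp only at ha ha'
    rw [ha, ha']
  have hors : ∀ i, (ands i).Finite → (ors i).Finite := fun i hi =>
    Set.Finite.of_injOn (f := OrNode.parent) (fun o ho => ho.1)
      (fun o ho o' ho' h => hinj i o ho o' ho' h) hi
  have hands : ∀ i, (ands i).Finite := by
    intro i
    induction i with
    | zero =>
      refine (Set.finite_singleton (⟨r, .root⟩ : R.AndNode r)).subset ?_
      rintro ⟨s, p⟩ hp
      change Follows S 0 p at hp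
      cases hp
      rfl
    | succ i ih =>
      have hU : (⋃ o ∈ ors i, Set.range fun s : R.goals o.alt => o.child s.1 s.2).Finite :=
        (hors i ih).biUnion fun o _ =>
          have := (hfin _ o.alt).to_subtype
          Set.finite_range _
      refine hU.subset ?_
      rintro ⟨s, p⟩ hp
      change Follows S (i + 1) p at hp
      cases hp with
      | @child _ t p a hp ha _ h =>
        simp only [Set.mem_iUnion]
        exact ⟨⟨⟨t, p⟩, a⟩, ⟨hp, ha⟩, ⟨s, h⟩, rfl⟩
  have hle : ∀ {i : ℕ} {s : R.Label} {p : R.AndPath r s}, Follows S i p → i ≤ K := fun h =>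
    have ⟨_, _, hk⟩ := hgood h
    by omega
  let T : R.DerivationSubtree r :=
    { ands := ⋃ i ∈ Set.Iic K, ands i
      ors := ⋃ i ∈ Set.Iic K, ors i
      parent_mem_ands := by
        simp only [Set.mem_iUnion]
        rintro o ⟨i, hi, ho⟩
        exact ⟨i, hi, ho.1⟩
      parent_mem_ors := by
        simp only [Set.mem_iUnion]
        rintro o s h ⟨i, hi, hp⟩
        change Follows S i (.child o.parent.path o.alt s h) at hp
        cases hp with
        | child hp ha _ _ => exact ⟨_, hle hp, hp, ha⟩
      root_mem := Set.mem_biUnion (Nat.zero_le K) Follows.root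
      one_child := by
        simp only [Set.mem_iUnion]
        rintro p ⟨i, hi, hp⟩
        obtain ⟨k, hk, -⟩ := hgood hp
        refine ⟨⟨p, f i p.label ⟨k, hk⟩⟩, ⟨⟨i, hi, hp, _, rfl⟩, rfl⟩, ?_⟩
        rintro o ⟨⟨j, hj, ho⟩, rfl⟩
        have hij := hp.depth_eq.symm.trans ho.1.depth_eq
        obtain rfl : i = j := by omega
        exact hinj i _ ho _ ⟨hp, _, rfl⟩ rfl
      all_children := by
        simp only [Set.mem_iUnion]
        rintro o ⟨i, hi, ho⟩ s h
        have hc : Follows S (i + 1) (o.child s h).path := .child ho.1 ho.2 s h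
        exact ⟨i + 1, hle hc, hc⟩ }
  refine ⟨T, ⟨(Set.finite_Iic K).biUnion fun i _ => hands i,
    (Set.finite_Iic K).biUnion fun i _ => hors i (hands i),
    fun p hp => (T.one_child p hp).exists⟩, fun o ho => ?_⟩
  simp only [T, Set.mem_iUnion] at ho
  obtain ⟨i, -, hp, h, ha⟩ := ho
  exact ⟨i, by rw [OrNode.depth, hp.depth_eq], ha ▸ hfQ i _ h⟩

/-- The depths of the `∨`-nodes of a derivation subtree form an initial segment of the odd
numbers. -/
theorem DerivationSubtree.exists_or_of_le {r : R.Label} (T : R.DerivationSubtree r) {j : ℕ}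
    (hj : ∃ o ∈ T.ors, o.depth = 2 * j + 1) {i : ℕ} (hij : i ≤ j) :
    ∃ o ∈ T.ors, o.depth = 2 * i + 1 := by
  induction hij using Nat.decreasingInduction with
  | self => exact hj
  | of_succ i _ ih =>
    obtain ⟨⟨⟨s, p⟩, a⟩, ho, hd⟩ := ih
    cases p with
    | root => simp [OrNode.depth, AndPath.depth] at hd
    | @child t p b _ h =>
      refine ⟨⟨⟨t, p⟩, b⟩, T.parent_mem_ors ⟨⟨t, p⟩, b⟩ s h (T.parent_mem_ands _ ho), ?_⟩
      simp only [OrNode.depth, AndPath.depth] at hd ⊢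
      omega

end AndOrRules

/-! ### Instances of atoms and clauses -/

variable {L : FirstOrder.Language.{u, v}}

section Instances

variable {X Y Z : Type}

theorem atom_subst_var (A : Atom L X) : A.subst Term.var = A := by
  simp [Atom.subst, term_subst_var]

theorem atom_subst_subst (A : Atom L X) (σ : X → L.Term Y) (τ : Y → L.Term Z) :
    (A.subst σ).subst τ = A.subst fun x => (σ x).subst τ := by
  simp [Atom.subst, term_subst_subst]

theorem Subst.andThen_assoc {a b c d : ℕ} (σ : Subst L a b) (τ : Subst L b c) (ρ : Subst L c d) :
    (σ.andThen τ).andThen ρ = σ.andThen (τ.andThen ρ) :=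
  funext fun _ => term_subst_subst _ _ _

theorem Subst.andThen_id {a b : ℕ} (σ : Subst L a b) : σ.andThen (Subst.id L b) = σ :=
  funext fun _ => term_subst_var _

theorem Subst.id_andThen {a b : ℕ} (σ : Subst L a b) : (Subst.id L a).andThen σ = σ := rfl

theorem atom_subst_id {n : ℕ} (A : Atom L (Fin n)) : A.subst (Subst.id L n) = A :=
  atom_subst_var A

theorem atom_subst_andThen {a b c : ℕ} (A : Atom L (Fin a)) (σ : Subst L a b)
    (τ : Subst L b c) : A.subst (σ.andThen τ) = (A.subst σ).subst τ :=
  (atom_subst_subst A σ τ).symm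

theorem Atom.finite_vars (A : Atom L ℕ) : A.vars.Finite := by
  refine (Set.finite_iUnion fun i => (A.args i).varFinset.finite_toSet).subset ?_
  rintro x ⟨i, hi⟩
  exact Set.mem_iUnion.2 ⟨i, hi⟩

theorem Clause.finite_vars (C : Clause L) : C.vars.Finite := by
  refine (C.head.finite_vars.union
    ((List.finite_toSet C.body).biUnion fun B _ => B.finite_vars)).subset ?_
  rintro x (hx | ⟨B, hB, hx⟩)
  · exact Or.inl hx
  · exact Or.inr (Set.mem_biUnion hB hx)

theorem Clause.headInst_subst (C : Clause L) {m k : ℕ} (τ : C.vars → L.Term (Fin m))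
    (ρ : Subst L m k) : (C.headInst τ).subst ρ = C.headInst fun x => (τ x).subst ρ :=
  atom_subst_subst _ _ _

/-- The instances of the atoms of the body of a clause, as a list. -/
def Clause.bodyList (C : Clause L) {m : ℕ} (τ : C.vars → L.Term (Fin m)) :
    List (Atom L (Fin m)) :=
  C.body.attach.map fun B => (B.1.restrict C.vars fun _ hx => Or.inr ⟨B.1, B.2, hx⟩).subst τ

theorem Clause.mem_bodyList {C : Clause L} {m : ℕ} {τ : C.vars → L.Term (Fin m)}
    {B : Atom L (Fin m)} : B ∈ C.bodyList τ ↔ B ∈ C.bodyInst τ := by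
  simp [Clause.bodyList, Clause.bodyInst, eq_comm]

theorem Clause.finite_bodyInst (C : Clause L) {m : ℕ} (τ : C.vars → L.Term (Fin m)) :
    (C.bodyInst τ).Finite :=
  (List.finite_toSet (C.bodyList τ)).subset fun _ h => Clause.mem_bodyList.2 h

theorem Clause.bodyList_subst (C : Clause L) {m k : ℕ} (τ : C.vars → L.Term (Fin m))
    (ρ : Subst L m k) :
    (C.bodyList τ).map (fun B => B.subst ρ) = C.bodyList fun x => (τ x).subst ρ := by
  simp [Clause.bodyList, atom_subst_subst, Function.comp_def]

theorem Clause.exists_of_mem_bodyInst_subst {C : Clause L} {m k : ℕ}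
    {τ : C.vars → L.Term (Fin m)} {ρ : Subst L m k} {B : Atom L (Fin k)}
    (hB : B ∈ C.bodyInst fun x => (τ x).subst ρ) : ∃ B' ∈ C.bodyInst τ, B'.subst ρ = B := by
  obtain ⟨B₀, h₀, rfl⟩ := hB
  exact ⟨_, ⟨B₀, h₀, rfl⟩, atom_subst_subst _ _ _⟩

/-- An atom and the head of a clause that have a unifier have a most general one, through which the
given unifier factors. -/
theorem exists_isMGU {n m : ℕ} {A : Atom L (Fin n)} {C : Clause L} {θ : Subst L n m}
    {τ : C.vars → L.Term (Fin m)} (h : A.subst θ = C.headInst τ) :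
    ∃ (k : ℕ) (σ : Subst L n k) (τ' : C.vars → L.Term (Fin k)) (ρ : Subst L k m),
      IsMGU A C σ τ' ∧ σ.andThen ρ = θ ∧ (fun x => (τ' x).subst ρ) = τ := by
  have := C.finite_vars.to_subtype
  obtain ⟨k, σ, τ', hmgu⟩ := exists_atom_mgu A _ θ τ h
  obtain ⟨ρ, hρ, -⟩ := hmgu.2 m θ τ h
  exact ⟨k, σ, τ', ρ, hmgu, funext hρ.1, funext hρ.2⟩

end Instances

/-- The atom `A` in context `m` has a refutation by term matching with at most `k` matching steps on
every branch. -/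
abbrev MatchSolvable (P : Program L) {m : ℕ} (k : ℕ) (A : Atom L (Fin m)) : Prop :=
  (coinductiveRules P m).Solvable k A

theorem exists_matchSolvable {P : Program L} {m : ℕ} {A : Atom L (Fin m)} {C : Clause L}
    (hC : C ∈ P) (τ : C.vars → L.Term (Fin m)) (h : A = C.headInst τ)
    (hB : ∀ B ∈ C.bodyInst τ, ∃ k, MatchSolvable P k B) : ∃ k, MatchSolvable P k A :=
  AndOrRules.exists_solvable (R := coinductiveRules P m) (⟨C, hC, τ, h⟩ : Matcher P A)
    (C.finite_bodyInst τ) hB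

/-! ### Coinductive trees and SLD-resolution -/

/-- Soundness of SLD-resolution. -/
theorem ComputedAnswer.exists_matchSolvable {P : Program L} {n m : ℕ} {G : Set (Atom L (Fin n))}
    {τ : Subst L n m} (h : ComputedAnswer P G τ) {p : ℕ} (σ : Subst L m p) :
    ∀ A ∈ G, ∃ k, MatchSolvable P k (A.subst (τ.andThen σ)) := by
  induction h with
  | done => simp
  | step G A hA C hC σ₁ τ₁ hmgu ρ hrest ih =>
    intro B hB
    rw [Subst.andThen_assoc, atom_subst_andThen]
    by_cases hBA : B = A
    · subst hBA
      rw [hmgu.1, C.headInst_subst]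
      refine LogicProg.exists_matchSolvable hC _ rfl fun B' hB' => ?_
      obtain ⟨B₁, hB₁, rfl⟩ := C.exists_of_mem_bodyInst_subst hB'
      exact ih σ B₁ (Or.inl hB₁)
    · exact ih σ _ (Or.inr ⟨B, ⟨hB, hBA⟩, rfl⟩)

/-- Every goal that is covered by a list of atoms whose instances under some `θ` form the list `l`
has `θ` as a correct answer. Lists keep apart atoms that are identified by `θ`, and this makes it
possible to replace the atoms of `l` one at a time. -/
def Liftable (P : Program L) {m : ℕ} (l : List (Atom L (Fin m))) : Prop :=
  ∀ (n : ℕ) (θ : Subst L n m) (t : List (Atom L (Fin n))) (G : Set (Atom L (Fin n))),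
    (t.map fun B => B.subst θ) = l → (∀ B ∈ G, B ∈ t) → CorrectAnswer P G θ

theorem liftable_nil (P : Program L) (m : ℕ) : Liftable P ([] : List (Atom L (Fin m))) := by
  intro n θ t G ht hG
  obtain rfl := List.map_eq_nil_iff.1 ht
  obtain rfl : G = ∅ := Set.eq_empty_of_forall_notMem fun B hB => List.not_mem_nil (hG B hB)
  exact ⟨n, Subst.id L n, θ, .done n, Subst.id_andThen θ⟩

/-- The lifting of one step: a resolution step by term matching on an instance of a goal comes from
a step of SLD-resolution on the goal itself. -/
theorem Liftable.cons_of_matcher {P : Program L} {m : ℕ} {B : Atom L (Fin m)}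
    {l : List (Atom L (Fin m))} {C : Clause L} (hC : C ∈ P) {τ : C.vars → L.Term (Fin m)}
    (hB : B = C.headInst τ) (hl : Liftable P l) (hbody : Liftable P (C.bodyList τ ++ l)) :
    Liftable P (B :: l) := by
  intro n θ t G ht hG
  match t, ht, hG with
  | A :: t, ht, hG =>
    obtain ⟨hA, ht⟩ := List.cons.inj ht
    by_cases hAG : A ∈ G
    · obtain ⟨k, σ, τ', ρ, hmgu, rfl, rfl⟩ := exists_isMGU (hA.trans hB)
      obtain ⟨p, τ₁, σ₁, hcomp, rfl⟩ := hbody k ρ (C.bodyList τ' ++ t.map fun B => B.subst σ)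
        (C.bodyInst τ' ∪ (fun B => B.subst σ) '' (G \ {A}))
        (by simp [C.bodyList_subst, ← ht, Function.comp_def, atom_subst_andThen])
        (by
          rintro B' (hB' | ⟨B', ⟨hB', hne⟩, rfl⟩)
          · exact List.mem_append_left _ (Clause.mem_bodyList.2 hB')
          · exact List.mem_append_right _
              (List.mem_map_of_mem ((List.mem_cons.1 (hG B' hB')).resolve_left hne)))
      exact ⟨p, _, σ₁, .step G A hAG C hC σ τ' hmgu τ₁ hcomp, Subst.andThen_assoc _ _ _⟩
    · refine hl n θ t G ht fun B' hB' => (List.mem_cons.1 (hG B' hB')).resolve_left ?_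
      rintro rfl
      exact hAG hB'

theorem Liftable.append {P : Program L} {m : ℕ} {l₁ l₂ : List (Atom L (Fin m))}
    (h₁ : ∀ B ∈ l₁, ∀ l, Liftable P l → Liftable P (B :: l)) (h₂ : Liftable P l₂) :
    Liftable P (l₁ ++ l₂) := by
  induction l₁ with
  | nil => exact h₂
  | cons B l₁ ih =>
    exact h₁ B List.mem_cons_self _ (ih fun B' hB' => h₁ B' (List.mem_cons_of_mem _ hB'))

theorem Liftable.cons_of_matchSolvable {P : Program L} {m k : ℕ} {B : Atom L (Fin m)}
    (h : MatchSolvable P k B) : ∀ l, Liftable P l → Liftable P (B :: l) := by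
  induction k generalizing B with
  | zero => nomatch h
  | succ k ih =>
    intro l hl
    obtain ⟨a, ha⟩ := h
    exact hl.cons_of_matcher a.mem a.eq
      (Liftable.append (fun B hB => ih (ha B (Clause.mem_bodyList.1 hB))) hl)

/-- Completeness of SLD-resolution. -/
theorem correctAnswer_of_matchSolvable {P : Program L} {n m k : ℕ} {A : Atom L (Fin n)}
    {θ : Subst L n m} (h : MatchSolvable P k (A.subst θ)) : CorrectAnswer P {A} θ :=
  Liftable.cons_of_matchSolvable h [] (liftable_nil P m) n θ [A] {A} rfl (by simp)

/-! ### Coinductive trees and saturated trees -/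

theorem IsComposite.exists_of_cons {n m k : ℕ} {σ : Subst L n m} {l : List (Arrow L)} {a : ℕ}
    {θ : Subst L a k} (h : IsComposite (⟨n, m, σ⟩ :: l) θ) :
    ∃ (e : a = n) (θ' : Subst L m k), IsComposite l θ' ∧ e ▸ θ = σ.andThen θ' := by
  cases h with
  | cons σ l θ' h => exact ⟨rfl, θ', h, rfl⟩

/-- An `∧`-node of a refutation subtree becomes solvable by term matching when it is instantiated by
the composite of the labels that occur below it. -/
theorem HasAnswer.exists_matchSolvable {P : Program L} {n m : ℕ} {A : Atom L (Fin n)}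
    {T : (saturatedRules P).DerivationSubtree ⟨n, A⟩} (hT : T.IsRefutation) {θ : Subst L n m}
    (h : HasAnswer T θ) : ∃ k, MatchSolvable P k (A.subst θ) := by
  obtain ⟨l, -, hl, hcomp⟩ := h
  have key : ∀ (j i : ℕ), l.length ≤ i + j → ∀ (a : ℕ) (B : Atom L (Fin a))
      (p : (saturatedRules P).AndPath ⟨n, A⟩ ⟨a, B⟩) (θ' : Subst L a m),
      (⟨⟨a, B⟩, p⟩ : (saturatedRules P).AndNode ⟨n, A⟩) ∈ T.ands → p.depth = 2 * i →
      IsComposite (l.drop i) θ' → ∃ k, MatchSolvable P k (B.subst θ') := by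
    intro j
    induction j with
    | zero =>
      intro i hi a B p θ' hp hd _
      obtain ⟨⟨q, u⟩, ho, rfl⟩ := hT.2.2 _ hp
      obtain ⟨i', hi', hlab⟩ := hl _ ho
      obtain ⟨hlt, -⟩ := List.getElem?_eq_some_iff.1 hlab
      change p.depth + 1 = _ at hi'
      omega
    | succ j ih =>
      intro i hi a B p θ' hp hd hθ'
      obtain ⟨⟨q, u⟩, ho, rfl⟩ := hT.2.2 _ hp
      obtain ⟨i', hi', hlab⟩ := hl _ ho
      change p.depth + 1 = _ at hi'
      obtain rfl : i = i' := by omega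
      obtain ⟨hlt, hlab⟩ := List.getElem?_eq_some_iff.1 hlab
      rw [List.drop_eq_getElem_cons hlt, hlab] at hθ'
      obtain ⟨_, θ'', hθ'', heq⟩ := hθ'.exists_of_cons
      change θ' = _ at heq
      rw [heq, atom_subst_andThen, Unifier.eq u, Clause.headInst_subst]
      refine LogicProg.exists_matchSolvable (Unifier.mem u) _ rfl fun B' hB' => ?_
      obtain ⟨B₁, hB₁, rfl⟩ := Clause.exists_of_mem_bodyInst_subst hB'
      refine ih (i + 1) (by omega) _ B₁ (.child p u _ ⟨B₁, hB₁, rfl⟩) θ''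
        (T.all_children _ ho _ ⟨B₁, hB₁, rfl⟩) ?_ hθ''
      change p.depth + 2 = _
      omega
  exact key l.length 0 (by omega) n A .root θ T.root_mem rfl hcomp

/-- The label of the `∨`-nodes at depth `2 * i + 1` of a refutation subtree with answer `θ`: all the
instantiation is done in the first step, and the other steps are term matching. -/
def answerArrow {n m : ℕ} (θ : Subst L n m) : ℕ → Arrow L
  | 0 => ⟨n, m, θ⟩
  | _ + 1 => ⟨m, m, Subst.id L m⟩

theorem isComposite_replicate_id (m N : ℕ) :
    IsComposite (List.replicate N ⟨m, m, Subst.id L m⟩) (Subst.id L m) := by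
  induction N with
  | zero => exact .nil m
  | succ N ih => exact .cons (Subst.id L m) _ _ ih

theorem exists_isSynched_of_matchSolvable {P : Program L} {n m k : ℕ} {A : Atom L (Fin n)}
    {θ : Subst L n m} (h : MatchSolvable P k (A.subst θ)) :
    ∃ T : (saturatedRules P).DerivationSubtree ⟨n, A⟩,
      IsSynched T ∧ T.IsRefutation ∧ HasAnswer T θ := by
  let Good : ℕ → ℕ → (saturatedRules P).Label → Prop := fun i k s =>
    match i with
    | 0 => s = ⟨n, A⟩ ∧ MatchSolvable P k (A.subst θ)
    | _ + 1 => ∃ B : Atom L (Fin m), s = ⟨m, B⟩ ∧ MatchSolvable P k B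
  let Q : ℕ → (s : (saturatedRules P).Label) → (saturatedRules P).Alt s → Prop := fun i s a =>
    (⟨s.1, Unifier.target a, Unifier.σ a⟩ : Arrow L) = answerArrow θ i
  have hstep : ∀ i k s, Good i k s → ∃ a : (saturatedRules P).Alt s, Q i s a ∧
      ∃ k' < k, ∀ s' ∈ (saturatedRules P).goals a, Good (i + 1) k' s' := by
    rintro (_ | i) k s hs
    · obtain ⟨rfl, @⟨k, _, a, ha⟩⟩ := hs
      refine ⟨(⟨a.clause, a.mem, m, θ, a.τ, a.eq⟩ : Unifier P A), rfl, k, k.lt_succ_self, ?_⟩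
      rintro s' ⟨B, hB, rfl⟩
      exact ⟨B, rfl, ha B hB⟩
    · obtain ⟨B, rfl, @⟨k, _, a, ha⟩⟩ := hs
      refine ⟨(⟨a.clause, a.mem, m, Subst.id L m, a.τ, (atom_subst_id B).trans a.eq⟩ :
        Unifier P B), rfl, k, k.lt_succ_self, ?_⟩
      rintro s' ⟨B', hB', rfl⟩
      exact ⟨B', rfl, ha B' hB'⟩
  have hfin : ∀ (s : (saturatedRules P).Label) (a : (saturatedRules P).Alt s),
      ((saturatedRules P).goals a).Finite := by
    intro s a
    refine ((Clause.finite_bodyInst _ (Unifier.τ a)).image fun B => ⟨_, B⟩).subset ?_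
    rintro s' ⟨B, hB, rfl⟩
    exact ⟨B, hB, rfl⟩
  have hroot : Good 0 k ⟨n, A⟩ := ⟨rfl, h⟩
  obtain ⟨T, hT, hors⟩ := AndOrRules.exists_isRefutation hfin Good Q hstep hroot
  refine ⟨T, fun o ho o' ho' hd => ?_, hT, ?_⟩
  · obtain ⟨i, hi, hQ⟩ := hors o ho
    obtain ⟨i', hi', hQ'⟩ := hors o' ho'
    obtain rfl : i = i' := by omega
    exact hQ.trans hQ'.symm
  -- A node of maximal depth determines how many identities follow `θ` in the answer.
  obtain ⟨o₀, ho₀, -⟩ := hT.2.2 _ T.root_mem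
  obtain ⟨o, ho, hmax⟩ := hT.2.1.exists_maximalFor (fun o => o.depth) _ ⟨o₀, ho₀⟩
  obtain ⟨N, hN, -⟩ := hors o ho
  refine ⟨⟨n, m, θ⟩ :: List.replicate N ⟨m, m, Subst.id L m⟩, fun i hi => ?_,
    fun o' ho' => ?_, ?_⟩
  · simp only [List.length_cons, List.length_replicate] at hi
    exact T.exists_or_of_le ⟨o, ho, hN⟩ (Nat.le_of_lt_succ hi)
  · obtain ⟨i, hi, hQ⟩ := hors o' ho'
    refine ⟨i, hi, ?_⟩
    have hle : o'.depth ≤ o.depth := (le_total o'.depth o.depth).elim _root_.id (hmax ho')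
    change orLabel o' = _ at hQ
    rw [hQ]
    match i with
    | 0 => rfl
    | i + 1 =>
      rw [List.getElem?_cons_succ, List.getElem?_replicate, if_pos (by omega)]
      rfl
  · have := IsComposite.cons θ _ _ (isComposite_replicate_id (L := L) m N)
    rwa [Subst.andThen_id] at this

theorem exists_isRefutation_of_matchSolvable {P : Program L} {m k : ℕ} {A : Atom L (Fin m)}
    (h : MatchSolvable P k A) :
    ∃ T : (coinductiveRules P m).DerivationSubtree A, T.IsRefutation := by
  obtain ⟨T, hT, -⟩ := AndOrRules.exists_isRefutation (R := coinductiveRules P m)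
    (fun _ a => Clause.finite_bodyInst _ (Matcher.τ a))
    (fun _ k s => (coinductiveRules P m).Solvable k s) (fun _ _ _ => True)
    (by
      rintro i _ s @⟨k, _, a, ha⟩
      exact ⟨a, trivial, k, k.lt_succ_self, ha⟩) h
  exact ⟨T, hT⟩

end LogicProg

open LogicProg in
theorem mainTheorem1 {L : FirstOrder.Language.{u, v}} (P : Program L) {n m : ℕ}
    (A : Atom L (Fin n)) (θ : Subst L n m) :
    List.TFAE [
      ∃ T : (saturatedRules P).DerivationSubtree ⟨n, A⟩,
        IsSynched T ∧ T.IsRefutation ∧ HasAnswer T θ,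
      ∃ T : (coinductiveRules P m).DerivationSubtree (A.subst θ), T.IsRefutation,
      CorrectAnswer P {A} θ] := by
  tfae_have 1 → 2 := fun ⟨_, _, hT, hθ⟩ =>
    have ⟨_, hk⟩ := hθ.exists_matchSolvable hT
    exists_isRefutation_of_matchSolvable hk
  tfae_have 2 → 1 := fun ⟨_, hT⟩ =>
    have ⟨_, hk⟩ := hT.exists_solvable
    exists_isSynched_of_matchSolvable hk
  tfae_have 2 → 3 := fun ⟨_, hT⟩ =>
    have ⟨_, hk⟩ := hT.exists_solvable
    correctAnswer_of_matchSolvable hk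
  tfae_have 3 → 2 := by
    rintro ⟨k, τ, σ, hτ, rfl⟩
    obtain ⟨_, hk⟩ := hτ.exists_matchSolvable σ A rfl
    exact exists_isRefutation_of_matchSolvable hk
  tfae_finish
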